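/- For a two-sided sequence $(\alpha_n)_{n\in\mathbb Z}$ in the open unit disc $\mathbb D=\{w\in\mathbb C:|w|<1\}$ put $\rho_n=(1-|\alpha_n|^2)^{1/2}$. The extended CMV matrix with Verblunsky coefficients $(\alpha_n)$ is the unitary operator $\mathcal E$ on $\ell^2(\mathbb Z)$ whose matrix has, for each $j\in\mathbb Z$, in the columns $2j-1,2j,2j+1,2j+2$ of the rows $2j$ and $2j+1$, respectively, the entries $$(\bar\alpha_{2j}\rho_{2j-1},\ -\bar\alpha_{2j}\alpha_{2j-1},\ \bar\alpha_{2j+1}\rho_{2j},\ \rho_{2j+1}\rho_{2j}),\qquad (\rho_{2j}\rho_{2j-1},\ -\rho_{2j}\alpha_{2j-1},\ -\bar\alpha_{2j+1}\alpha_{2j},\ -\rho_{2j+1}\alpha_{2j}),$$ and zeros elsewhere. **Theorem.** Let $\nu$ be a Borel probability measure on $\mathbb D$ whose topological support $\mathrm{supp}\,\nu$ is a compact subset of $\mathbb D$. Let $\Omega=(\mathrm{supp}\,\nu)^{\mathbb Z}$, $\mu=\nu^{\mathbb Z}$, and for $\omega\in\Omega$ let $\mathcal E_\omega$ be the extended CMV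 matrix with Verblunsky coefficients $\alpha_n=\omega_n$, $n\in\mathbb Z$. Then there is a closed set $\Sigma_\mu\subseteq\partial\mathbb D$, the almost sure spectrum, such that $\sigma(\mathcal E_\omega)=\Sigma_\mu$ for $\mu$-almost every $\omega\in\Omega$, and any such set satisfies $$\Sigma_\mu=\overline{\bigcup_{p\ge 1}\ \bigcup_{\alpha_1,\dots,\alpha_p\in\mathrm{supp}\,\nu}\sigma(\mathcal E_{\alpha_1,\dots,\alpha_p})},$$ where $\mathcal E_{\alpha_1,\dots,\alpha_p}$ is the extended CMV matrix whose Verblunsky coefficients are the $p$-periodic sequence on $\mathbb Z$ with values $\alpha_1,\dots,\alpha_p$ at $n=1,\dots,p$. -/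

import Mathlib

open MeasureTheory Complex
open scoped ComplexConjugate Complex.UnitDisc ENNReal

noncomputable section

namespace RandomCMV

/-! ### Extended CMV matrices -/

/-- The Hilbert space `ℓ²(ℤ)`. -/
abbrev ellTwo : Type := lp (fun _ : ℤ => ℂ) 2

/-- `ρ = (1 - |α|²)^{1/2}` for a Verblunsky coefficient `α` in the open unit disc. -/
def rho (a : 𝔻) : ℝ := Real.sqrt (1 - ‖(a : ℂ)‖ ^ 2)

/-- The `(m, n)` entry of the extended CMV matrix with Verblunsky coefficients `α : ℤ → 𝔻`.
Rows `2j` and `2j + 1` both live on the columns `2j - 1, 2j, 2j + 1, 2j + 2`, where they are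
`(ᾱ₂ⱼ ρ₂ⱼ₋₁, -ᾱ₂ⱼ α₂ⱼ₋₁, ᾱ₂ⱼ₊₁ ρ₂ⱼ, ρ₂ⱼ₊₁ ρ₂ⱼ)` and
`(ρ₂ⱼ ρ₂ⱼ₋₁, -ρ₂ⱼ α₂ⱼ₋₁, -ᾱ₂ⱼ₊₁ α₂ⱼ, -ρ₂ⱼ₊₁ α₂ⱼ)`. -/
def cmvEntry (α : ℤ → 𝔻) (m n : ℤ) : ℂ :=
  if Even m then
    if n = m - 1 then conj (α m : ℂ) * rho (α (m - 1))
    else if n = m then -(conj (α m : ℂ) * (α (m - 1) : ℂ))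
    else if n = m + 1 then conj (α (m + 1) : ℂ) * rho (α m)
    else if n = m + 2 then (rho (α (m + 1)) : ℂ) * rho (α m)
    else 0
  else
    if n = m - 2 then (rho (α (m - 1)) : ℂ) * rho (α (m - 2))
    else if n = m - 1 then -((rho (α (m - 1)) : ℂ) * (α (m - 2) : ℂ))
    else if n = m then -(conj (α m : ℂ) * (α (m - 1) : ℂ))
    else if n = m + 1 then -((rho (α m) : ℂ) * (α (m - 1) : ℂ))
    else 0

theorem norm_rho_le_one (a : 𝔻) : ‖(rho a : ℂ)‖ ≤ 1 := by
  rw [Complex.norm_real, Real.norm_of_nonneg (show 0 ≤ rho a from Real.sqrt_nonneg _)]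
  exact Real.sqrt_le_one.mpr (by nlinarith [norm_nonneg (a : ℂ)])

theorem norm_cmvEntry_le_one (α : ℤ → 𝔻) (m n : ℤ) : ‖cmvEntry α m n‖ ≤ 1 := by
  have ha : ∀ k, ‖(α k : ℂ)‖ ≤ 1 := fun k => (α k).norm_lt_one.le
  have hr : ∀ k, ‖(rho (α k) : ℂ)‖ ≤ 1 := fun k => norm_rho_le_one (α k)
  unfold cmvEntry
  split_ifs <;>
    simp only [norm_neg, norm_mul, RCLike.norm_conj, norm_zero, zero_le_one] <;>
    exact mul_le_one₀ (by first | exact ha _ | exact hr _) (norm_nonneg _)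
      (by first | exact ha _ | exact hr _)

theorem summable_sq_norm_shift (u : ellTwo) (k : ℤ) :
    Summable fun n : ℤ => ‖u (n + k)‖ ^ (2 : ℝ≥0∞).toReal :=
  ((lp.memℓp u).summable (by norm_num)).comp_injective (add_left_injective k)

theorem norm_mul_rpow_le {c x : ℂ} (hc : ‖c‖ ≤ 1) :
    ‖c * x‖ ^ (2 : ℝ≥0∞).toReal ≤ ‖x‖ ^ (2 : ℝ≥0∞).toReal := by
  refine Real.rpow_le_rpow (norm_nonneg _) ?_ (by norm_num)
  rw [norm_mul]
  exact mul_le_of_le_one_left (norm_nonneg _) hc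

/-- The bounded operator on `ℓ²(ℤ)` whose matrix has the single diagonal `n ↦ (n, n + k)`, with the
(bounded) entries `c n` on it: `(diagOp c u)(n) = c n * u (n + k)`. -/
def diagOp (c : ℤ → ℂ) (hc : ∀ n, ‖c n‖ ≤ 1) (k : ℤ) : ellTwo →L[ℂ] ellTwo :=
  LinearMap.mkContinuous
    { toFun := fun u => ⟨fun n => c n * u (n + k), memℓp_gen <|
        (summable_sq_norm_shift u k).of_nonneg_of_le (fun _ => by positivity)
          (fun n => norm_mul_rpow_le (hc n))⟩
      map_add' := fun u v => by
        ext n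
        exact mul_add (c n) (u (n + k)) (v (n + k))
      map_smul' := fun a u => by
        ext n
        exact mul_left_comm (c n) a (u (n + k)) }
    1 (fun u => by
      rw [one_mul]
      refine lp.norm_le_of_tsum_le (by norm_num) (norm_nonneg _) ?_
      rw [lp.norm_rpow_eq_tsum (by norm_num) u]
      have hu := (lp.memℓp u).summable (show 0 < (2 : ℝ≥0∞).toReal by norm_num)
      refine ((summable_sq_norm_shift u k).of_nonneg_of_le (fun _ => by positivity)
          (fun n => norm_mul_rpow_le (hc n))).tsum_le_tsum
            (fun n => norm_mul_rpow_le (hc n)) (summable_sq_norm_shift u k) |>.trans ?_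
      exact ((Equiv.addRight k).tsum_eq (fun n => ‖u n‖ ^ (2 : ℝ≥0∞).toReal)).le)

/-- The extended CMV matrix with Verblunsky coefficients `α`, as a bounded operator on `ℓ²(ℤ)`:
the sum of its five diagonals. -/
def extendedCMV (α : ℤ → 𝔻) : ellTwo →L[ℂ] ellTwo :=
  ∑ k ∈ Finset.Icc (-2 : ℤ) 2,
    diagOp (fun n => cmvEntry α n (n + k)) (fun n => norm_cmvEntry_le_one α n (n + k)) k

theorem extendedCMV_apply (α : ℤ → 𝔻) (u : ellTwo) (n : ℤ) :
    extendedCMV α u n = ∑ k ∈ Finset.Icc (-2 : ℤ) 2, cmvEntry α n (n + k) * u (n + k) := by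
  unfold extendedCMV
  rw [_root_.sum_apply, lp.coeFn_sum, Finset.sum_apply]
  rfl

/-- The operator `extendedCMV α` has the matrix `cmvEntry α` in the standard basis. -/
theorem extendedCMV_single (α : ℤ → 𝔻) (m n : ℤ) :
    extendedCMV α (lp.single 2 n (1 : ℂ)) m = cmvEntry α m n := by
  rw [extendedCMV_apply]
  simp only [lp.single_apply, Pi.single_apply, mul_ite, mul_one, mul_zero]
  by_cases h : n - m ∈ Finset.Icc (-2 : ℤ) 2
  · rw [Finset.sum_eq_single_of_mem (n - m) h
      (fun k _ hk => if_neg fun h' => hk (by omega)), if_pos (by omega)]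
    congr 1
    omega
  · rw [Finset.sum_eq_zero fun k hk => if_neg fun h' => h (by
      rwa [show n - m = k by omega])]
    rw [Finset.mem_Icc] at h
    unfold cmvEntry
    split_ifs <;> first | rfl | omega

/-- The `p`-periodic sequence `(αₙ)` on `ℤ` with `α₁ = a 0, …, α_p = a (p - 1)`. -/
def periodicSeq {X : Type*} {p : ℕ} (hp : 0 < p) (a : Fin p → X) (n : ℤ) : X :=
  a ⟨((n - 1) % (p : ℤ)).toNat, by
    have h₁ := Int.emod_nonneg (n - 1) (show (p : ℤ) ≠ 0 by omega)
    have h₂ := Int.emod_lt_of_pos (n - 1) (show (0 : ℤ) < p by omega)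
    omega⟩

/-! ### The random model -/

/-- The open unit disc carries its Borel `σ`-algebra. -/
instance instMeasurableSpaceUnitDisc : MeasurableSpace 𝔻 := borel 𝔻

instance instBorelSpaceUnitDisc : BorelSpace 𝔻 := ⟨rfl⟩

instance instSecondCountableUnitDisc : SecondCountableTopology 𝔻 :=
  UnitDisc.isEmbedding_coe.secondCountableTopology

/-- The sample space `Ω = (supp ν)^ℤ`. -/
abbrev Omega (ν : Measure 𝔻) : Type := ℤ → ν.support

/-- The measure `ν`, regarded as a measure on its own topological support. -/
def onSupport (ν : Measure 𝔻) : Measure ν.support := ν.comap Subtype.val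

/-- `onSupport ν` is a probability measure if `ν` is. -/
instance instIsProbabilityMeasureOnSupport (ν : Measure 𝔻) [IsProbabilityMeasure ν] :
    IsProbabilityMeasure (onSupport ν) :=
  (MeasurableEmbedding.subtype_coe
    (Measure.isClosed_support (μ := ν)).measurableSet).isProbabilityMeasure_comap <| by
      rw [Subtype.range_coe]
      exact Measure.support_mem_ae

/-- The product measure `μ = ν^ℤ` on `Ω = (supp ν)^ℤ`. -/
def productMeasure (ν : Measure 𝔻) : Measure (Omega ν) :=
  Measure.infinitePi fun _ : ℤ => onSupport ν

/-- The random extended CMV matrix `𝓔_ω`, with Verblunsky coefficients `(ω n)`, `n ∈ ℤ`. -/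
def randomCMV {ν : Measure 𝔻} (ω : Omega ν) : ellTwo →L[ℂ] ellTwo :=
  extendedCMV fun n => (ω n : 𝔻)

/-- `S` is the almost sure spectrum `Σ_μ` of the family `(𝓔_ω)`: a closed subset of the unit circle
with `σ(𝓔_ω) = S` for `μ`-almost every `ω`. -/
def IsAlmostSureSpectrum (ν : Measure 𝔻) (S : Set ℂ) : Prop :=
  IsClosed S ∧ S ⊆ Metric.sphere (0 : ℂ) 1 ∧
    ∀ᵐ ω ∂(productMeasure ν), spectrum ℂ (randomCMV ω) = S

/-- The union, over all periods `p ≥ 1` and all `α₁, …, α_p ∈ supp ν`, of the spectra of the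
periodic extended CMV matrices `𝓔_{α₁, …, α_p}`. -/
def periodicSpectra (ν : Measure 𝔻) : Set ℂ :=
  ⋃ (p : ℕ) (hp : 0 < p) (a : Fin p → ν.support),
    spectrum ℂ (extendedCMV (periodicSeq hp fun i => (a i : 𝔻)))

end RandomCMV

end

/-! An extended CMV matrix is unitary, hence normal, so a point is within `ε` of the spectrum as
soon as one vector is an `ε`-approximate eigenvector, and every spectral point has such vectors. A
fixed test vector stays good when finitely many coefficients are nearly unchanged, whatever the
others do, because the operator depends strongly continuously on the sequence in the product
topology. Hence the spectrum can only lose points in a limit, never gain them abruptly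
(`eventually_exists_mem_spectrum`).

It remains to approximate in the product topology, in both directions. Periodic sequences are dense
(`exists_periodicSeq_mem`), so spectral points of `𝓔_ω` are limits of periodic spectral points.
Conversely, almost every `ω` has a dense orbit under even shifts
(`ae_forall_exists_even_shift_mem`), and these preserve the spectrum, so every periodic spectrum
lies in `σ(𝓔_ω)`. -/

namespace RandomCMV
open Filter Topology

/-! ### Approximate eigenvectors of normal operators -/

section Normal

variable {H : Type*} [NormedAddCommGroup H] [InnerProductSpace ℂ H] [CompleteSpace H]

theorem isStarNormal_algebraMap_sub (A : H →L[ℂ] H) [IsStarNormal A] (z : ℂ) :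
    IsStarNormal (algebraMap ℂ (H →L[ℂ] H) z - A) := by
  refine ⟨?_⟩
  rw [star_sub, ← algebraMap_star_comm]
  exact (Algebra.commute_algebraMap_left _ _).sub_left
    ((Algebra.commute_algebraMap_right _ _).sub_right star_comm_self)

/-- Every spectral value of a normal operator is an approximate eigenvalue. -/
theorem exists_norm_lt_of_mem_spectrum (A : H →L[ℂ] H) [IsStarNormal A] {z : ℂ}
    (hz : z ∈ spectrum ℂ A) {ε : ℝ} (hε : 0 < ε) : ∃ v : H, ‖z • v - A v‖ < ε * ‖v‖ := by
  by_contra! h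
  have := isStarNormal_algebraMap_sub A z
  set B := algebraMap ℂ (H →L[ℂ] H) z - A with hB
  have hBv : ∀ v, B v = z • v - A v := fun v => by
    simp [hB, Algebra.algebraMap_eq_smul_one]
  refine hz ?_
  -- `B` is bounded below by `ε`, so `star B * B` is coercive with constant `ε ^ 2`. Since the two
  -- factors commute, invertibility of the product passes to `B`.
  have hu : IsUnit (star B * B) := by
    refine ContinuousLinearMap.isUnit_of_forall_le_norm_inner_map _
      (c := (ε ^ 2).toNNReal)
      (Real.toNNReal_pos.mpr (by positivity)) fun x => ?_
    rw [mul_apply_eq_comp, ContinuousLinearMap.star_eq_adjoint,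
      ContinuousLinearMap.adjoint_inner_left, inner_self_eq_norm_sq_to_K, norm_pow]
    have h1 := h x
    rw [← hBv] at h1
    have h2 : (ε * ‖x‖) ^ 2 ≤ ‖B x‖ ^ 2 := by gcongr
    rw [Real.coe_toNNReal _ (by positivity)]
    refine le_trans (by linarith [mul_pow ε ‖x‖ 2]) (h2.trans (le_of_eq ?_))
    simp
  exact ((star_comm_self (x := B)).isUnit_mul_iff.mp hu).2

/-- An `ε`-approximate eigenvalue of a normal operator is `ε`-close to the spectrum. -/
theorem exists_mem_spectrum_norm_sub_le (A : H →L[ℂ] H) [IsStarNormal A] {z : ℂ} {ε : ℝ} {v : H}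
    (hv : ‖z • v - A v‖ < ε * ‖v‖) : ∃ w ∈ spectrum ℂ A, ‖z - w‖ < ε := by
  have hv0 : 0 < ‖v‖ := by
    rcases (norm_nonneg v).eq_or_lt with h | h
    · rw [← h, mul_zero] at hv
      exact absurd hv (norm_nonneg _).not_gt
    · exact h
  have hε : 0 < ε := pos_of_mul_pos_left ((norm_nonneg _).trans_lt hv) hv0.le
  have : Nontrivial H := ⟨v, 0, norm_pos_iff.mp hv0⟩
  by_cases hz : z ∈ spectrum ℂ A
  · exact ⟨z, hz, by simpa using hε⟩
  have := isStarNormal_algebraMap_sub A z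
  rw [spectrum.notMem_iff] at hz
  obtain ⟨B, hB⟩ := hz
  have : IsStarNormal (B : H →L[ℂ] H) := by rwa [hB]
  -- The resolvent is normal, so its norm is attained as `‖k‖` on its spectrum. Then `z - k⁻¹` lies
  -- in the spectrum of `A`, and `‖k‖ > 1 / ε` by applying the resolvent to `B v`.
  obtain ⟨k, hk, hkB⟩ := spectrum.exists_nnnorm_eq_spectralRadius (↑B⁻¹ : H →L[ℂ] H)
  rw [IsStarNormal.spectralRadius_eq_nnnorm] at hkB
  have hkB' : ‖k‖ = ‖(↑B⁻¹ : H →L[ℂ] H)‖ := by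
    exact congrArg NNReal.toReal (ENNReal.coe_injective hkB)
  rw [← spectrum.map_inv, Set.mem_inv, hB] at hk
  have hBv : (B : H →L[ℂ] H) v = z • v - A v := by
    simp [hB, Algebra.algebraMap_eq_smul_one]
  have hinv : (↑B⁻¹ : H →L[ℂ] H) ((B : H →L[ℂ] H) v) = v := by
    rw [← mul_apply_eq_comp, Units.inv_mul, one_apply_eq_self]
  have h1 : ‖v‖ ≤ ‖k‖ * ‖z • v - A v‖ := by
    rw [hkB', ← hBv]
    exact (congrArg norm hinv).ge.trans (ContinuousLinearMap.le_opNorm _ _)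
  have hk0 : 0 < ‖k‖ := by
    rcases (norm_nonneg k).eq_or_lt with h | h
    · rw [← h, zero_mul] at h1
      exact absurd h1 hv0.not_ge
    · exact h
  refine ⟨z - k⁻¹, ?_, ?_⟩
  · rw [spectrum.mem_iff] at hk ⊢
    convert! (not_congr (IsUnit.neg_iff _)).mpr hk using 2
    rw [map_sub]
    abel
  · rw [sub_sub_cancel, norm_inv, inv_lt_iff_one_lt_mul₀ hk0]
    have : ‖v‖ < ‖k‖ * (ε * ‖v‖) := h1.trans_lt (by gcongr)
    by_contra! hc
    nlinarith

end Normal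

/-! ### Unitarity through the factorization into `2 × 2` blocks -/

section Unitary

theorem diagOp_apply (c : ℤ → ℂ) (hc : ∀ n, ‖c n‖ ≤ 1) (k : ℤ) (u : ellTwo) (n : ℤ) :
    diagOp c hc k u n = c n * u (n + k) := rfl

theorem star_diagOp (c : ℤ → ℂ) (hc : ∀ n, ‖c n‖ ≤ 1) (k : ℤ) :
    star (diagOp c hc k) =
      diagOp (fun n => conj (c (n - k))) (fun n => by simpa using hc (n - k)) (-k) := by
  rw [ContinuousLinearMap.star_eq_adjoint, eq_comm, ContinuousLinearMap.eq_adjoint_iff]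
  intro u v
  rw [lp.inner_eq_tsum, lp.inner_eq_tsum, ← (Equiv.addRight k).tsum_eq]
  refine tsum_congr fun n => ?_
  simp only [Equiv.coe_addRight, diagOp_apply, RCLike.inner_apply, map_mul, add_sub_cancel_right,
    Complex.conj_conj, add_neg_cancel_right]
  ring

/-- The diagonal part, and the off-diagonal part, of the direct sum of the `2 × 2` blocks
`(ᾱₙ, ρₙ; ρₙ, -αₙ)` sitting at the coordinates `n, n + 1` with `Even (n + b)`. -/
noncomputable def blockDiag (b : ℤ) (α : ℤ → 𝔻) (n : ℤ) : ℂ :=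
  if Even (n + b) then conj (α n : ℂ) else -(α (n - 1) : ℂ)

/-- The superdiagonal of the direct sum of the blocks. -/
noncomputable def blockUpper (b : ℤ) (α : ℤ → 𝔻) (n : ℤ) : ℂ :=
  if Even (n + b) then (rho (α n) : ℂ) else 0

/-- The subdiagonal of the direct sum of the blocks. -/
noncomputable def blockLower (b : ℤ) (α : ℤ → 𝔻) (n : ℤ) : ℂ :=
  if Even (n + b) then 0 else (rho (α (n - 1)) : ℂ)

theorem norm_blockDiag_le_one (b : ℤ) (α : ℤ → 𝔻) (n : ℤ) : ‖blockDiag b α n‖ ≤ 1 := by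
  unfold blockDiag
  split_ifs
  · simpa using (α n).norm_lt_one.le
  · simpa using (α (n - 1)).norm_lt_one.le

theorem norm_blockUpper_le_one (b : ℤ) (α : ℤ → 𝔻) (n : ℤ) : ‖blockUpper b α n‖ ≤ 1 := by
  unfold blockUpper
  split_ifs
  · exact norm_rho_le_one _
  · simp

theorem norm_blockLower_le_one (b : ℤ) (α : ℤ → 𝔻) (n : ℤ) : ‖blockLower b α n‖ ≤ 1 := by
  unfold blockLower
  split_ifs
  · simp
  · exact norm_rho_le_one _

/-- The direct sum of the `2 × 2` blocks `(ᾱₙ, ρₙ; ρₙ, -αₙ)` sitting at the coordinates `n, n + 1`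
with `Even (n + b)`. -/
noncomputable def blockOp (b : ℤ) (α : ℤ → 𝔻) : ellTwo →L[ℂ] ellTwo :=
  diagOp (blockDiag b α) (norm_blockDiag_le_one b α) 0 +
    diagOp (blockUpper b α) (norm_blockUpper_le_one b α) 1 +
    diagOp (blockLower b α) (norm_blockLower_le_one b α) (-1)

theorem blockOp_apply (b : ℤ) (α : ℤ → 𝔻) (u : ellTwo) (n : ℤ) :
    blockOp b α u n = if Even (n + b) then conj (α n : ℂ) * u n + rho (α n) * u (n + 1)
      else rho (α (n - 1)) * u (n - 1) - α (n - 1) * u n := by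
  have : blockOp b α u n = blockDiag b α n * u (n + 0) + blockUpper b α n * u (n + 1) +
      blockLower b α n * u (n + -1) := rfl
  rw [this, blockDiag, blockUpper, blockLower, add_zero, ← sub_eq_add_neg]
  split_ifs <;> ring

theorem rho_star (a : 𝔻) : rho (star a) = rho a := by
  simp [rho]

theorem rho_mul_rho (a : 𝔻) : (rho a : ℂ) * rho a = 1 - conj (a : ℂ) * a := by
  rw [← Complex.ofReal_mul, rho, Real.mul_self_sqrt, Complex.conj_mul']
  · push_cast
    rfl
  · nlinarith [norm_nonneg (a : ℂ), a.norm_lt_one]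

/-- The blocks are symmetric with real off-diagonal entries, so taking adjoints only conjugates the
coefficients. -/
theorem star_blockOp (b : ℤ) (α : ℤ → 𝔻) :
    star (blockOp b α) = blockOp b fun n => star (α n) := by
  ext u n
  have : star (blockOp b α) u n = conj (blockDiag b α (n - 0)) * u (n + -0) +
      conj (blockUpper b α (n - 1)) * u (n + -1) +
      conj (blockLower b α (n - -1)) * u (n + - -1) := by
    simp only [blockOp, star_add, star_diagOp]
    rfl
  rw [this, blockOp_apply, blockDiag, blockUpper, blockLower]
  have e1 : Even (n - 1 + b) ↔ ¬ Even (n + b) := by grind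
  have e2 : Even (n - -1 + b) ↔ ¬ Even (n + b) := by grind
  simp only [sub_zero, neg_zero, add_zero, e1, e2, neg_neg, ← sub_eq_add_neg, rho_star]
  split_ifs
  · simp
  · simp
    ring

theorem blockOp_star_mul (b : ℤ) (α : ℤ → 𝔻) :
    (blockOp b fun n => star (α n)) * blockOp b α = 1 := by
  ext u n
  have e1 : Even (n - 1 + b) ↔ ¬ Even (n + b) := by grind
  have e2 : Even (n + 1 + b) ↔ ¬ Even (n + b) := by grind
  rw [mul_apply_eq_comp, one_apply_eq_self, blockOp_apply, blockOp_apply,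
    blockOp_apply, blockOp_apply]
  simp only [e1, e2, rho_star, UnitDisc.coe_star, Complex.conj_conj, add_sub_cancel_right,
    sub_add_cancel]
  have h0 := rho_mul_rho (α n)
  have h1 := rho_mul_rho (α (n - 1))
  split_ifs with h
  · linear_combination (u n) * h0
  · linear_combination (u n) * h1

theorem blockOp_mem_unitary (b : ℤ) (α : ℤ → 𝔻) : blockOp b α ∈ unitary (ellTwo →L[ℂ] ellTwo) := by
  rw [Unitary.mem_iff, star_blockOp]
  refine ⟨blockOp_star_mul b α, ?_⟩
  simpa using blockOp_star_mul b fun n => star (α n)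

/-- The factor with offset `0` has its blocks starting at even sites, the one with offset `1` at odd
sites. Unitarity, opaque from the five diagonals, is then checked block by block. -/
theorem extendedCMV_eq_mul (α : ℤ → 𝔻) : extendedCMV α = blockOp 0 α * blockOp 1 α := by
  ext u n
  rw [mul_apply_eq_comp, extendedCMV_apply, blockOp_apply, blockOp_apply,
    blockOp_apply, blockOp_apply]
  have e0 : Even (n + 1) ↔ ¬ Even n := by grind
  have e2 : Even (n + 1 + 1) ↔ Even n := by grind
  have hI : Finset.Icc (-2 : ℤ) 2 = {-2, -1, 0, 1, 2} := by decide
  have s1 : n + 1 + 1 = n + 2 := by ring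
  have s2 : n - 1 - 1 = n - 2 := by ring
  have t1 : n + -2 = n - 2 := by ring
  have t2 : n + -1 = n - 1 := by ring
  simp only [hI, cmvEntry, add_zero, sub_add_cancel, e0, e2]
  have d1 : ∀ a b : ℤ, a ≠ -b → (n + a = n - b) = False := fun a b hab => by
    simp only [eq_iff_iff, iff_false]
    omega
  have d2 : ∀ b : ℤ, b ≠ 0 → (n = n - b) = False := fun b hb => by
    simp only [eq_iff_iff, iff_false]
    omega
  by_cases h : Even n
  · simp [h, d1, d2, t1, t2, s1]
    ring
  · simp [h, d1, d2, t1, t2, s2]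
    ring

theorem extendedCMV_mem_unitary (α : ℤ → 𝔻) :
    extendedCMV α ∈ unitary (ellTwo →L[ℂ] ellTwo) :=
  extendedCMV_eq_mul α ▸ mul_mem (blockOp_mem_unitary 0 α) (blockOp_mem_unitary 1 α)

instance isStarNormal_extendedCMV (α : ℤ → 𝔻) : IsStarNormal (extendedCMV α) :=
  ⟨by rw [commute_iff_eq, (Unitary.mem_iff.mp (extendedCMV_mem_unitary α)).1,
    (Unitary.mem_iff.mp (extendedCMV_mem_unitary α)).2]⟩

end Unitary

/-! ### Invariance under even shifts -/

section Shift

/-- Translation by `k` on `ℓ²(ℤ)`. -/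
noncomputable def translation (k : ℤ) : ellTwo →L[ℂ] ellTwo := diagOp (fun _ => 1) (by simp) k

theorem translation_apply (k : ℤ) (u : ellTwo) (n : ℤ) : translation k u n = u (n + k) :=
  one_mul _

/-- Translation as a unit of the algebra of bounded operators. -/
noncomputable def translationUnit (k : ℤ) : (ellTwo →L[ℂ] ellTwo)ˣ where
  val := translation k
  inv := translation (-k)
  val_inv := by
    ext u n
    simp [translation_apply]
  inv_val := by
    ext u n
    simp [translation_apply]

/-- The shape of a row depends on its parity, which is why the shift has to be even. -/
theorem cmvEntry_even_shift (α : ℤ → 𝔻) (k m n : ℤ) :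
    cmvEntry (fun i => α (i + 2 * k)) m n = cmvEntry α (m + 2 * k) (n + 2 * k) := by
  have e : Even (m + 2 * k) ↔ Even m := by grind
  have h1 : ∀ j : ℤ, n + 2 * k = m + 2 * k - j ↔ n = m - j := fun j => by omega
  simp only [cmvEntry, e, h1, add_left_inj, sub_add_eq_add_sub, add_right_comm m]

/-- Even shifts of the Verblunsky coefficients do not change the spectrum. -/
theorem spectrum_extendedCMV_even_shift (α : ℤ → 𝔻) (k : ℤ) :
    spectrum ℂ (extendedCMV fun i => α (i + 2 * k)) = spectrum ℂ (extendedCMV α) := by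
  rw [← spectrum.units_conjugate (a := extendedCMV α) (u := translationUnit (2 * k))]
  congr 1
  ext u n
  change _ = translation (2 * k) (extendedCMV α (translation (-(2 * k)) u)) n
  rw [translation_apply, extendedCMV_apply, extendedCMV_apply]
  refine Finset.sum_congr rfl fun j _ => ?_
  rw [translation_apply, cmvEntry_even_shift, add_right_comm n j, add_right_comm n,
    add_neg_cancel_right]

end Shift

/-! ### Strong continuity and lower semicontinuity of the spectrum -/

section Continuity

theorem continuous_rho : Continuous rho := by
  unfold rho
  fun_prop

theorem continuous_cmvEntry (m n : ℤ) : Continuous fun α : ℤ → 𝔻 => cmvEntry α m n := by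
  have hr : ∀ k : ℤ, Continuous fun α : ℤ → 𝔻 => (rho (α k) : ℂ) := fun k =>
    Complex.continuous_ofReal.comp (continuous_rho.comp (continuous_apply k))
  have ha : ∀ k : ℤ, Continuous fun α : ℤ → 𝔻 => (α k : ℂ) := fun k => by fun_prop
  have hc : ∀ k : ℤ, Continuous fun α : ℤ → 𝔻 => conj (α k : ℂ) := fun k =>
    Complex.continuous_conj.comp (ha k)
  unfold cmvEntry
  split_ifs <;> fun_prop

/-- Entrywise continuity suffices once the vector is fixed, by dominated convergence: the difference
of two entries has norm at most `2`, giving the summable bound `4 * ‖u (n + k)‖ ^ 2`. -/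
theorem continuous_diagOp_apply {X : Type*} [TopologicalSpace X] (c : X → ℤ → ℂ)
    (hc : ∀ x n, ‖c x n‖ ≤ 1) (hcont : ∀ n, Continuous fun x => c x n) (k : ℤ) (u : ellTwo) :
    Continuous fun x => diagOp (c x) (hc x) k u := by
  rw [continuous_iff_continuousAt]
  intro x
  rw [ContinuousAt, tendsto_iff_norm_sub_tendsto_zero]
  have key : ∀ y, ‖diagOp (c y) (hc y) k u - diagOp (c x) (hc x) k u‖ ^ 2 =
      ∑' n, ‖(c y n - c x n) * u (n + k)‖ ^ 2 := fun y => by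
    have h := lp.norm_rpow_eq_tsum (p := 2) (by norm_num)
      (diagOp (c y) (hc y) k u - diagOp (c x) (hc x) k u)
    simp only [ENNReal.toReal_ofNat, Real.rpow_ofNat] at h
    rw [h]
    refine tsum_congr fun n => ?_
    rw [lp.coeFn_sub, Pi.sub_apply, diagOp_apply, diagOp_apply, sub_mul]
  have hs : Summable fun n : ℤ => 4 * ‖u (n + k)‖ ^ 2 := by
    have := (summable_sq_norm_shift u k).mul_left 4
    simpa using this
  have hlim : Tendsto (fun y => ∑' n, ‖(c y n - c x n) * u (n + k)‖ ^ 2) (𝓝 x)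
      (𝓝 (∑' _ : ℤ, (0 : ℝ))) := by
    refine tendsto_tsum_of_dominated_convergence hs (fun n => ?_)
      (Eventually.of_forall fun y n => ?_)
    · have := hcont n
      refine Continuous.tendsto' (by fun_prop) x 0 (by simp)
    · rw [Real.norm_of_nonneg (by positivity), norm_mul, mul_pow]
      have : ‖c y n - c x n‖ ≤ 2 := (norm_sub_le _ _).trans (by linarith [hc y n, hc x n])
      gcongr
      nlinarith [norm_nonneg (c y n - c x n)]
  simp only [tsum_zero, ← key] at hlim
  simpa using hlim.sqrt

theorem continuous_extendedCMV_apply (u : ellTwo) :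
    Continuous fun α : ℤ → 𝔻 => extendedCMV α u := by
  simp only [extendedCMV, _root_.sum_apply]
  refine continuous_finsetSum _ fun k _ => ?_
  exact continuous_diagOp_apply (fun α n => cmvEntry α n (n + k))
    (fun α n => norm_cmvEntry_le_one α n (n + k)) (fun n => continuous_cmvEntry n (n + k)) k u

/-- The spectrum is lower semicontinuous in the Verblunsky coefficients. -/
theorem eventually_exists_mem_spectrum (α : ℤ → 𝔻) {z : ℂ} (hz : z ∈ spectrum ℂ (extendedCMV α))
    {ε : ℝ} (hε : 0 < ε) : ∀ᶠ β in 𝓝 α, ∃ w ∈ spectrum ℂ (extendedCMV β), dist z w < ε := by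
  obtain ⟨v, hv⟩ := exists_norm_lt_of_mem_spectrum (extendedCMV α) hz hε
  have hc : Continuous fun β : ℤ → 𝔻 => ‖z • v - extendedCMV β v‖ :=
    (continuous_const.sub (continuous_extendedCMV_apply v)).norm
  filter_upwards [hc.continuousAt.eventually_lt_const hv] with β hβ
  simpa only [dist_eq_norm] using exists_mem_spectrum_norm_sub_le (extendedCMV β) hβ

end Continuity

/-! ### Density of periodic sequences and of random orbits -/

section Density

theorem exists_periodicSeq_mem {X : Type*} [TopologicalSpace X] {U : Set (ℤ → X)} (hU : IsOpen U)
    {α : ℤ → X} (hα : α ∈ U) :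
    ∃ (p : ℕ) (hp : 0 < p) (a : Fin p → X), periodicSeq hp a ∈ U := by
  obtain ⟨I, u, hu, hIU⟩ := isOpen_pi_iff.mp hU α hα
  obtain ⟨R, hR⟩ : ∃ R : ℕ, ∀ i ∈ I, i.natAbs ≤ R :=
    ⟨I.sup Int.natAbs, fun i hi => Finset.le_sup (f := Int.natAbs) hi⟩
  -- Repeat the window `[-R, R]` of `α`. As `periodicSeq` lists the sites `1, …, 2R + 1`, those
  -- beyond `R` are moved back by one period into the window.
  refine ⟨2 * R + 1, by omega,
    fun i => α (if (i : ℤ) + 1 ≤ R then i + 1 else i + 1 - (2 * R + 1)), hIU fun n hn => ?_⟩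
  have h := hR n hn
  suffices periodicSeq (p := 2 * R + 1) (by omega)
      (fun i => α (if (i : ℤ) + 1 ≤ R then i + 1 else i + 1 - (2 * R + 1))) n = α n from
    this ▸ (hu n hn).2
  simp only [periodicSeq]
  congr 1
  have h₁ := Int.emod_nonneg (n - 1) (show ((2 * R + 1 : ℕ) : ℤ) ≠ 0 by omega)
  have h₂ : n - 1 = (n - 1) % ((2 * R + 1 : ℕ) : ℤ) ∨
      n - 1 = (n - 1) % ((2 * R + 1 : ℕ) : ℤ) - (2 * R + 1) := by
    rcases le_or_gt 1 n with h1 | h1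
    · left
      rw [Int.emod_eq_of_lt] <;> omega
    · right
      rw [← Int.add_emod_right, Int.emod_eq_of_lt] <;> push_cast <;> omega
  have h₃ := Int.emod_lt_of_pos (n - 1) (show (0 : ℤ) < ((2 * R + 1 : ℕ) : ℤ) by omega)
  rw [Int.toNat_of_nonneg h₁]
  split_ifs <;> omega

/-- A basic open set constrains finitely many sites. Its translates to disjoint windows are
independent events of equal positive probability, so almost surely one of them occurs. -/
theorem ae_exists_even_shift_mem {X : Type*} [TopologicalSpace X] [MeasurableSpace X]
    [OpensMeasurableSpace X] (m : Measure X) [IsProbabilityMeasure m] [m.IsOpenPosMeasure]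
    {U : Set (ℤ → X)} (hU : IsOpen U) (hne : U.Nonempty) :
    ∀ᵐ ω ∂(Measure.infinitePi fun _ : ℤ => m), ∃ k : ℤ, (fun n => ω (n + 2 * k)) ∈ U := by
  obtain ⟨α, hα⟩ := hne
  obtain ⟨I, u, hu, hIU⟩ := isOpen_pi_iff.mp hU α hα
  obtain ⟨R, hR⟩ : ∃ R : ℕ, ∀ i ∈ I, i.natAbs ≤ R :=
    ⟨I.sup Int.natAbs, fun i hi => Finset.le_sup (f := Int.natAbs) hi⟩
  -- The step `2 * (R + 1)` is even and exceeds the diameter `2 * R` of the window, so the copies of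
  -- `I` are disjoint.
  let f : ℕ × I → ℤ := fun x => x.2 + 2 * ((R + 1) * x.1)
  have hf : Function.Injective f := by
    rintro ⟨k, i⟩ ⟨l, j⟩ h
    simp only [f] at h
    have hi := hR i i.2
    have hj := hR j j.2
    have hkl : k = l := by
      rcases lt_trichotomy k l with hkl | hkl | hkl
      · have : ((R : ℤ) + 1) * (k + 1) ≤ (R + 1) * l := by gcongr; exact_mod_cast hkl
        rw [mul_add] at this
        omega
      · exact hkl
      · have : ((R : ℤ) + 1) * (l + 1) ≤ (R + 1) * k := by gcongr; exact_mod_cast hkl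
        rw [mul_add] at this
        omega
    subst hkl
    have : (i : ℤ) = j := by omega
    rw [Subtype.ext this]
  let F : (ℤ → X) → ℕ → I → X := fun ω k i => ω (f (k, i))
  have hFm : Measurable F := by fun_prop
  -- This is the independence of the windows: their joint law is a product of copies of one law.
  have hF : (Measure.infinitePi fun _ : ℤ => m).map F =
      Measure.infinitePi fun _ : ℕ => Measure.infinitePi fun _ : I => m := by
    rw [← Measure.infinitePi_map_curry (fun _ _ => m),
      ← Measure.map_infinitePi_infinitePi_of_inj (P := fun _ : ℤ => m) hf,
      Measure.map_map (by fun_prop) (by fun_prop)]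
    rfl
  let B : Set (I → X) := Set.univ.pi fun i => u i
  have hBm : MeasurableSet B := MeasurableSet.univ_pi fun i => (hu i i.2).1.measurableSet
  have hB : (Measure.infinitePi fun _ : I => m) B ≠ 0 := by
    have := Measure.infinitePi_pi (fun _ : I => m) (s := Finset.univ) (t := fun i => u i)
      fun i _ => (hu i i.2).1.measurableSet
    rw [Finset.coe_univ] at this
    rw [this]
    exact Finset.prod_ne_zero_iff.mpr fun i _ =>
      (hu i i.2).1.measure_ne_zero m ⟨α i, (hu i i.2).2⟩
  have hBc : (Measure.infinitePi fun _ : I => m) Bᶜ < 1 := by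
    rw [prob_compl_eq_one_sub hBm]
    exact ENNReal.sub_lt_self ENNReal.one_ne_top one_ne_zero hB
  have hnull : (Measure.infinitePi fun _ : ℤ => m) (F ⁻¹' {x | ∀ k, x k ∈ Bᶜ}) = 0 := by
    have hle : ∀ n : ℕ, (Measure.infinitePi fun _ : ℤ => m) (F ⁻¹' {x | ∀ k, x k ∈ Bᶜ}) ≤
        (Measure.infinitePi fun _ : I => m) Bᶜ ^ n := fun n => by
      have h1 := Measure.infinitePi_pi (fun _ : ℕ => Measure.infinitePi fun _ : I => m)
        (s := Finset.range n) (t := fun _ => Bᶜ) fun _ _ => hBm.compl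
      rw [Finset.prod_const, Finset.card_range] at h1
      rw [← h1, ← hF, Measure.map_apply hFm
        (MeasurableSet.pi (Set.to_countable _) fun _ _ => hBm.compl)]
      exact measure_mono fun ω hω k _ => hω k
    exact le_antisymm (ge_of_tendsto' (ENNReal.tendsto_pow_atTop_nhds_zero_of_lt_one hBc) hle)
      (zero_le)
  filter_upwards [compl_mem_ae_iff.mpr hnull] with ω hω
  simp only [Set.mem_compl_iff, Set.mem_preimage, Set.mem_ofPred_eq, not_forall, not_not] at hω
  obtain ⟨k, hk⟩ := hω
  exact ⟨(R + 1) * k, hIU fun i hi => hk ⟨i, hi⟩ trivial⟩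

instance isOpenPosMeasure_onSupport (ν : Measure 𝔻) : (onSupport ν).IsOpenPosMeasure := by
  refine ⟨fun U hU ⟨x, hx⟩ => ?_⟩
  obtain ⟨V, hV, rfl⟩ := isOpen_induced_iff.mp hU
  rw [onSupport, (MeasurableEmbedding.subtype_coe
    (Measure.isClosed_support (μ := ν)).measurableSet).comap_apply,
    Subtype.image_preimage_coe, Set.inter_comm, measure_inter_conull Measure.support_mem_ae]
  exact (Measure.mem_support_iff_forall _ |>.mp x.2 V (hV.mem_nhds hx)).ne'

/-- Almost every sequence has a dense orbit under the even shifts. -/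
theorem ae_forall_exists_even_shift_mem (ν : Measure 𝔻) [IsProbabilityMeasure ν] :
    ∀ᵐ ω ∂(productMeasure ν), ∀ U : Set (Omega ν), IsOpen U → U.Nonempty →
      ∃ k : ℤ, (fun n => ω (n + 2 * k)) ∈ U := by
  -- A countable basis allows a single null set to serve all open sets.
  have h : ∀ᵐ ω ∂(productMeasure ν), ∀ U ∈ TopologicalSpace.countableBasis (Omega ν),
      ∃ k : ℤ, (fun n => ω (n + 2 * k)) ∈ U :=
    (ae_ball_iff (TopologicalSpace.countable_countableBasis _)).mpr fun U hU =>
      ae_exists_even_shift_mem (onSupport ν) (TopologicalSpace.isOpen_of_mem_countableBasis hU)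
        (TopologicalSpace.nonempty_of_mem_countableBasis hU)
  filter_upwards [h] with ω hω U hU ⟨x, hx⟩
  obtain ⟨V, hV, -, hVU⟩ :=
    (TopologicalSpace.isBasis_countableBasis (Omega ν)).exists_subset_of_mem_open hx hU
  obtain ⟨k, hk⟩ := hω V hV
  exact ⟨k, hVU hk⟩

theorem continuous_coe_seq (ν : Measure 𝔻) :
    Continuous fun (ω : Omega ν) (n : ℤ) => (ω n : 𝔻) := by
  fun_prop

theorem ae_spectrum_randomCMV_eq (ν : Measure 𝔻) [IsProbabilityMeasure ν] :
    ∀ᵐ ω ∂(productMeasure ν), spectrum ℂ (randomCMV ω) = closure (periodicSpectra ν) := by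
  filter_upwards [ae_forall_exists_even_shift_mem ν] with ω hω
  have nhd : ∀ (θ : Omega ν) {z : ℂ}, z ∈ spectrum ℂ (randomCMV θ) → ∀ ε > 0, ∃ U : Set (Omega ν),
      IsOpen U ∧ θ ∈ U ∧ ∀ β ∈ U, ∃ w ∈ spectrum ℂ (randomCMV β), dist z w < ε :=
    fun θ z hz ε hε => by
      have h := (continuous_coe_seq ν).continuousAt.eventually
        (eventually_exists_mem_spectrum _ hz hε)
      obtain ⟨U, hU, hUo, hθ⟩ := mem_nhds_iff.mp h
      exact ⟨U, hUo, hθ, fun β hβ => hU hβ⟩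
  apply subset_antisymm
  · intro z hz
    rw [Metric.mem_closure_iff]
    intro ε hε
    obtain ⟨U, hU, hωU, hUs⟩ := nhd ω hz ε hε
    obtain ⟨p, hp, a, ha⟩ := exists_periodicSeq_mem hU hωU
    obtain ⟨w, hw, hzw⟩ := hUs _ ha
    exact ⟨w, Set.mem_iUnion.mpr ⟨p, Set.mem_iUnion.mpr ⟨hp, Set.mem_iUnion.mpr ⟨a, hw⟩⟩⟩, hzw⟩
  · refine closure_minimal ?_ (spectrum.isClosed _)
    intro z hz
    simp only [periodicSpectra, Set.mem_iUnion] at hz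
    obtain ⟨p, hp, a, hz⟩ := hz
    rw [← (spectrum.isClosed (randomCMV ω)).closure_eq, Metric.mem_closure_iff]
    intro ε hε
    obtain ⟨U, hU, hαU, hUs⟩ := nhd (periodicSeq hp a) hz ε hε
    obtain ⟨k, hk⟩ := hω U hU ⟨_, hαU⟩
    obtain ⟨w, hw, hzw⟩ := hUs _ hk
    exact ⟨w, (spectrum_extendedCMV_even_shift (fun n => (ω n : 𝔻)) k).subset hw, hzw⟩

theorem periodicSpectra_subset_sphere (ν : Measure 𝔻) :
    periodicSpectra ν ⊆ Metric.sphere (0 : ℂ) 1 := by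
  simp only [periodicSpectra, Set.iUnion_subset_iff]
  exact fun p hp a => spectrum.subset_circle_of_unitary (extendedCMV_mem_unitary _)

end Density

end RandomCMV

theorem theorem3p3 (ν : MeasureTheory.Measure Complex.UnitDisc)
    [MeasureTheory.IsProbabilityMeasure ν] (hν : IsCompact ν.support) :
    (∃ S : Set ℂ, RandomCMV.IsAlmostSureSpectrum ν S) ∧
      ∀ S : Set ℂ, RandomCMV.IsAlmostSureSpectrum ν S →
        S = closure (RandomCMV.periodicSpectra ν) := by
  have h := RandomCMV.ae_spectrum_randomCMV_eq ν
  refine ⟨⟨closure (RandomCMV.periodicSpectra ν), isClosed_closure,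
    closure_minimal (RandomCMV.periodicSpectra_subset_sphere ν) Metric.isClosed_sphere, h⟩,
    fun S hS => ?_⟩
  -- A nonzero measure is needed for the two almost sure equalities to hold at a common `ω`.
  have : IsProbabilityMeasure (RandomCMV.productMeasure ν) := by
    unfold RandomCMV.productMeasure
    infer_instance
  obtain ⟨ω, h1, h2⟩ := (hS.2.2.and h).exists
  exact h1.symm.trans h2
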